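/- Fix an anisotropy parameter $\Delta^{-1}\in[0,1)$ and an energy $E_1<2(1-3\Delta^{-1})$, and put $I=[0,E_1]$. For a nonempty finite interval $\Lambda=[a,b]\cap\mathbb Z$ and a non-negative field $(b_s)_{s\in\Lambda}$, consider on $\mathcal H_\Lambda=\bigotimes_{s\in\Lambda}\mathbb C^2$ the XXZ Hamiltonian $$H_\Lambda=-\Delta^{-1}\sum_{s=a}^{b-1}\bigl(S^1_sS^1_{s+1}+S^2_sS^2_{s+1}\bigr)-\sum_{s=a}^{b-1}\bigl(S^3_sS^3_{s+1}-\tfrac14\bigr)+\tfrac12(1-\Delta^{-1})\bigl(1-S^3_a-S^3_b\bigr)+\sum_{s\in\Lambda}b_s\bigl(\tfrac12-S^3_s\bigr),$$ where $S^1,S^2,S^3$ are the spin matrices with eigenvalues $\pm\frac12$. Let $\mathcal X_\Lambda$ be the set of configurations $\mathbf x\subseteq\Lambda$ (sets of sites carrying a down spin), let $(\delta_{\mathbf x})_{\mathbf x\in\mathcal X_\Lambda}$ be the corresponding orthonormal product basis of $\mathcal H_\Lambda$, and write $\psi(\mathbf x)=\langle\delta_{\mathbf x},\psi\rangle$. Let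 $P_I(H_\Lambda)$ be the spectral projection of $H_\Lambda$ onto $I$ and $N_I(\mathbf x)=\langle\delta_{\mathbf x},P_I(H_\Lambda)\delta_{\mathbf x}\rangle$. Let $\mathcal C$ be the set of fully clustered configurations, that is, those $\mathbf y\in\mathcal X_\Lambda$ that consist of consecutive sites (the empty configuration included), and let $$d(\mathbf x,\mathcal C)=\min\Bigl\{\sum_{k=1}^{n}|x_k-y_k| \;:\; \mathbf y\in\mathcal C,\ |\mathbf y|=|\mathbf x|=n\Bigr\},$$ where $x_1<\dots<x_n$ and $y_1<\dots<y_n$ are the elements of $\mathbf x$ and $\mathbf y$. Then there are constants $\mu,C\in(0,\infty)$, depending only on $\Delta^{-1}$ and $E_1$, such that for all such $\Lambda$, all non-negative fields $(b_s)_{s\in\Lambda}$, all $\mathbf x\in\mathcal X_\Lambda$ and all normalized $\psi\in\operatorname{ran}P_I(H_\Lambda)$, $$|\psi(\mathbf x)|^2\le N_I(\mathbf x)\le C\,e^{-\mu\,d(\mathbf x,\mathcal C)},$$ the second inequality holding also when $\operatorname{ran}P_I(H_\Lambda)=\{0\}$. -/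

import Mathlib

noncomputable section

namespace XXZ

/-- Configurations of hard-core particles (down spins) on the chain `Λ = [a, b] ∩ ℤ`: a configuration is
identified with the set of sites that carry a down spin. -/
abbrev Config (a b : ℤ) : Type := ↥((Finset.Icc a b).powerset)

/-- The Hilbert space `⊗_{x ∈ Λ} ℂ²`, written in its orthonormal product basis: that basis is labelled
by the sets of down spins, so the space is `ℓ²` of the configurations. -/
abbrev HilbertSpace (a b : ℤ) : Type := EuclideanSpace ℂ (Config a b)

/-- The spin matrices, in the basis `0 = up`, `1 = down` of `ℂ²`. -/
def S1 : Matrix (Fin 2) (Fin 2) ℂ := !![0, 1 / 2; 1 / 2, 0]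

/-- The second spin matrix. -/
def S2 : Matrix (Fin 2) (Fin 2) ℂ := !![0, -(Complex.I / 2); Complex.I / 2, 0]

/-- The third spin matrix. -/
def S3 : Matrix (Fin 2) (Fin 2) ℂ := !![1 / 2, 0; 0, -(1 / 2)]

/-- The spin at the site `s`: `1` (down) if `s` is occupied, and `0` (up) otherwise. -/
def spinAt (x : Finset ℤ) (s : ℤ) : Fin 2 := if s ∈ x then 1 else 0

/-- The one-site matrix `M` lifted to the chain: it acts as `M` on the tensor factor of the site `s` and as the
identity on all other factors. -/
def siteOp (a b s : ℤ) (M : Matrix (Fin 2) (Fin 2) ℂ) : Matrix (Config a b) (Config a b) ℂ :=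
  Matrix.of fun x y =>
    if ∀ t ∈ Finset.Icc a b, t ≠ s → spinAt x.1 t = spinAt y.1 t then
      M (spinAt x.1 s) (spinAt y.1 s)
    else 0

/-- The XXZ Hamiltonian `h_Λ` on `Λ = [a, b] ∩ ℤ` with anisotropy parameter `q = Δ⁻¹` and boundary field
`β = (1 - q) / 2`. -/
def hXXZ (q : ℝ) (a b : ℤ) : Matrix (Config a b) (Config a b) ℂ :=
  -((q : ℂ) • ∑ s ∈ Finset.Ico a b,
      (siteOp a b s S1 * siteOp a b (s + 1) S1 + siteOp a b s S2 * siteOp a b (s + 1) S2))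
    - ∑ s ∈ Finset.Ico a b, (siteOp a b s S3 * siteOp a b (s + 1) S3 - (1 / 4 : ℂ) • 1)
    + (((1 - q) / 2 : ℝ) : ℂ) • (1 - siteOp a b a S3 - siteOp a b b S3)

/-- The full Hamiltonian `H_Λ = h_Λ + ∑_{s ∈ Λ} v_s (1/2 - S³_s)`. -/
def hamiltonian (q : ℝ) (a b : ℤ) (v : ℤ → ℝ) : Matrix (Config a b) (Config a b) ℂ :=
  hXXZ q a b + ∑ s ∈ Finset.Icc a b, (v s : ℂ) • ((1 / 2 : ℂ) • 1 - siteOp a b s S3)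

/-- The spectral projection `P_J(A)` of a Hermitian matrix `A`: the orthogonal projection onto the
span of the eigenvectors of `A` with eigenvalue in `J`. -/
def spectralProjection {ι : Type} [Fintype ι] [DecidableEq ι] (A : Matrix ι ι ℂ) (J : Set ℝ) :
    EuclideanSpace ℂ ι →L[ℂ] EuclideanSpace ℂ ι :=
  (⨆ E ∈ J, Module.End.eigenspace (Matrix.toEuclideanLin A) (E : ℂ)).starProjection

/-- The local integrated density of states `N_J(x) = ⟨δ_x, P_J(H_Λ) δ_x⟩`. -/
def localDOS (q : ℝ) (a b : ℤ) (v : ℤ → ℝ) (J : Set ℝ) (x : Config a b) : ℝ :=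
  (inner ℂ (EuclideanSpace.single x (1 : ℂ))
    (spectralProjection (hamiltonian q a b v) J (EuclideanSpace.single x (1 : ℂ)))).re

/-- The `ℓ¹` distance `∑ k, |x_k - y_k|` of two configurations of `n` particles with positions
`x_1 < ⋯ < x_n` and `y_1 < ⋯ < y_n`. -/
def configDist {n : ℕ} (x y : Finset ℤ) (hx : x.card = n) (hy : y.card = n) : ℕ :=
  ∑ k : Fin n, (x.orderEmbOfFin hx k - y.orderEmbOfFin hy k).natAbs

/-- Fully clustered configurations: the occupied sites form a chain of nearest neighbours
(vacuously so for the empty configuration). -/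
def IsClustered (x : Finset ℤ) : Prop := ∃ c d : ℤ, x = Finset.Icc c d

/-- The distances from `x` to the fully clustered configurations on `Λ` with as many particles as `x`. -/
def clusterDistSet {a b : ℤ} (x : Config a b) : Set ℕ :=
  {m | ∃ (y : Config a b) (hy : y.1.card = x.1.card), IsClustered y.1 ∧ m = configDist x.1 y.1 rfl hy}

theorem clusterDistSet_nonempty {a b : ℤ} (x : Config a b) : (clusterDistSet x).Nonempty := by
  have hsub := Finset.mem_powerset.1 x.2
  have hc := Finset.card_le_card hsub
  rw [Int.card_Icc] at hc
  have hy : Finset.Icc a (a + x.1.card - 1) ∈ (Finset.Icc a b).powerset := by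
    rw [Finset.mem_powerset]
    intro t ht
    rw [Finset.mem_Icc] at ht ⊢
    omega
  have hcard : (Finset.Icc a (a + x.1.card - 1)).card = x.1.card := by
    rw [Int.card_Icc]
    omega
  exact ⟨_, ⟨_, hy⟩, hcard, ⟨_, _, rfl⟩, rfl⟩

/-- The distance `d(x, 𝒞)` from `x` to the fully clustered configurations; the minimum is over a nonempty
set by `clusterDistSet_nonempty`. -/
def distToClustered {a b : ℤ} (x : Config a b) : ℕ := sInf (clusterDistSet x)

end XXZ

end

/-! Weight configurations by F = exp(2η d(·, 𝒞)). In the product basis the Hamiltonian is a sum,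
over bonds with unlike spins, of (1 - q · exchange)/2, plus a non-negative potential. An exchange
across such a bond changes d by at most 1, so the weighted hopping term costs only a factor cosh η.
Hence Re⟨Fψ, Hψ⟩ dominates (1 - q cosh η)/2 times the sum of F|ψ|² counted with the number of domain
walls, an occupied end counting as a wall. Non-clustered configurations have at least four walls and
clustered ones have F = 1, which gives `hamiltonian_coercive`: Re⟨Fψ, Hψ⟩ ≥ c(⟨ψ, Fψ⟩ - ‖ψ‖²) with c
= 2(1 - q cosh η), and c > E₁ for small η.

Decay follows by compressing F to the spectral subspace U (`weighted_norm_sq_le_of_mem_spectral`).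
If w ∈ U is an eigenvector of the compression with eigenvalue m, then Hw ∈ U yields ⟨Fw, Hw⟩ = m⟨w,
Hw⟩ ≤ mE₁‖w‖². So c(m - 1) ≤ mE₁, that is m ≤ c/(c - E₁), uniformly in the chain and the field.
Testing this bound on Pδ_x finishes the proof. -/

/-! ### Spectral subspaces and weighted quadratic forms -/

open Module.End in
theorem LinearMap.IsSymmetric.re_inner_le_of_eigenvalues_le {E : Type*} [NormedAddCommGroup E]
    [InnerProductSpace ℂ E] [FiniteDimensional ℂ E] {T : E →ₗ[ℂ] E} (hT : T.IsSymmetric) {K : ℝ}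
    (h : ∀ μ : ℝ, HasEigenvalue T (μ : ℂ) → μ ≤ K) (x : E) :
    (inner ℂ x (T x)).re ≤ K * ‖x‖ ^ 2 := by
  have e1 : (inner ℂ x (T x)).re =
      ∑ i, hT.eigenvalues rfl i * ‖(hT.eigenvectorBasis rfl).repr x i‖ ^ 2 := by
    rw [← LinearIsometryEquiv.inner_map_map (hT.eigenvectorBasis rfl).repr, PiLp.inner_apply,
      Complex.re_sum]
    refine Finset.sum_congr rfl fun i _ => ?_
    rw [hT.eigenvectorBasis_apply_self_apply rfl x i]
    simp only [RCLike.inner_apply, RCLike.ofReal_eq_complex_ofReal]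
    rw [mul_assoc, Complex.mul_conj, ← Complex.ofReal_mul, Complex.ofReal_re,
      Complex.normSq_eq_norm_sq]
  have e2 : ‖x‖ ^ 2 = ∑ i, ‖(hT.eigenvectorBasis rfl).repr x i‖ ^ 2 := by
    rw [← LinearIsometryEquiv.norm_map (hT.eigenvectorBasis rfl).repr, EuclideanSpace.norm_sq_eq]
  rw [e1, e2, Finset.mul_sum]
  exact Finset.sum_le_sum fun i _ =>
    mul_le_mul_of_nonneg_right (h _ (hT.hasEigenvalue_eigenvalues rfl i)) (sq_nonneg _)

section SpectralSubspace

open Module.End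

variable {E : Type*} [NormedAddCommGroup E] [InnerProductSpace ℂ E]

theorem iSup_eigenspace_invariant (T : E →ₗ[ℂ] E) (J : Set ℝ) :
    ∀ x ∈ ⨆ μ ∈ J, eigenspace T (μ : ℂ), T x ∈ ⨆ μ ∈ J, eigenspace T (μ : ℂ) := by
  intro x hx
  have : (⨆ μ ∈ J, eigenspace T (μ : ℂ)) ≤ (⨆ μ ∈ J, eigenspace T (μ : ℂ)).comap T := by
    refine iSup₂_le fun μ hμ y hy => ?_
    rw [Submodule.mem_comap, mem_eigenspace_iff.1 hy]
    exact Submodule.smul_mem _ _ ((le_iSup₂_of_le μ hμ le_rfl : eigenspace T (μ : ℂ) ≤ _) hy)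
  exact this hx

theorem LinearMap.IsSymmetric.re_inner_le_of_mem_iSup_eigenspace [FiniteDimensional ℂ E]
    {T : E →ₗ[ℂ] E} (hT : T.IsSymmetric) {J : Set ℝ} {K : ℝ} (hJ : ∀ μ ∈ J, μ ≤ K) {x : E}
    (hx : x ∈ ⨆ μ ∈ J, eigenspace T (μ : ℂ)) :
    (inner ℂ x (T x)).re ≤ K * ‖x‖ ^ 2 := by
  have hinv := iSup_eigenspace_invariant T J
  refine (hT.restrict_invariant hinv).re_inner_le_of_eigenvalues_le (K := K) (fun μ hμ => ?_) ⟨x, hx⟩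
  by_contra hK
  obtain ⟨w, hw⟩ := hμ.exists_hasEigenvector
  have hTw : T w = (μ : ℂ) • (w : E) := congrArg Subtype.val hw.apply_eq_smul
  -- An eigenvector in the subspace whose eigenvalue lies outside `J` is orthogonal to every
  -- spanning eigenspace, hence to itself.
  have hle : (⨆ ν ∈ J, eigenspace T (ν : ℂ)) ≤ (ℂ ∙ (w : E))ᗮ := by
    refine iSup₂_le fun ν hν y hy => ?_
    rw [Submodule.mem_orthogonal_singleton_iff_inner_right]
    have hne : (μ : ℂ) ≠ (ν : ℂ) := by
      intro h
      rw [Complex.ofReal_inj] at h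
      exact hK (h ▸ hJ ν hν)
    exact hT.orthogonalFamily_eigenspaces hne ⟨(w : E), mem_eigenspace_iff.2 hTw⟩ ⟨y, hy⟩
  have := (Submodule.mem_orthogonal_singleton_iff_inner_right).1 (hle w.2)
  exact hw.2 (Subtype.ext (inner_self_eq_zero.1 this))

end SpectralSubspace

/-- A coercivity bound for the weighted quadratic form forces weighted decay of spectral subspaces. -/
theorem weighted_norm_sq_le_of_mem_spectral {ι : Type} [Fintype ι] [DecidableEq ι]
    {A : Matrix ι ι ℂ} (hA : A.IsHermitian) {J : Set ℝ} {E₁ c : ℝ} (hJ : ∀ μ ∈ J, μ ≤ E₁)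
    (hc : E₁ < c) {F : ι → ℝ} (hF : ∀ x, 0 ≤ F x)
    (hcoer : ∀ ψ : EuclideanSpace ℂ ι, c * (∑ x, F x * ‖ψ x‖ ^ 2 - ‖ψ‖ ^ 2) ≤
      (∑ x, (F x : ℂ) * (star (ψ x) * A.toEuclideanLin ψ x)).re)
    {φ : EuclideanSpace ℂ ι}
    (hφ : φ ∈ ⨆ E ∈ J, Module.End.eigenspace (Matrix.toEuclideanLin A) (E : ℂ)) :
    ∑ x, F x * ‖φ x‖ ^ 2 ≤ c / (c - E₁) * ‖φ‖ ^ 2 := by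
  set U := ⨆ E ∈ J, Module.End.eigenspace (Matrix.toEuclideanLin A) (E : ℂ) with hU
  have hT : (Matrix.toEuclideanLin A).IsSymmetric := Matrix.isSymmetric_toEuclideanLin_iff.2 hA
  let D : EuclideanSpace ℂ ι →ₗ[ℂ] EuclideanSpace ℂ ι :=
    Matrix.toEuclideanLin (Matrix.diagonal fun x => (F x : ℂ))
  have hD : ∀ ψ x, D ψ x = F x * ψ x := by
    intro ψ x
    simp [D, Matrix.toLpLin_apply, Matrix.mulVec_diagonal]
  have hDs : D.IsSymmetric := by
    refine Matrix.isSymmetric_toEuclideanLin_iff.2 ?_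
    rw [Matrix.isHermitian_diagonal_iff]
    intro x
    simp [isSelfAdjoint_iff]
  have hDin : ∀ ψ χ : EuclideanSpace ℂ ι,
      inner ℂ (D ψ) χ = ∑ x, (F x : ℂ) * (star (ψ x) * χ x) := by
    intro ψ χ
    rw [PiLp.inner_apply]
    refine Finset.sum_congr rfl fun x _ => ?_
    rw [hD]
    simp only [RCLike.inner_apply, map_mul, Complex.conj_ofReal, RCLike.star_def]
    ring
  have hDself : ∀ ψ : EuclideanSpace ℂ ι, (inner ℂ ψ (D ψ)).re = ∑ x, F x * ‖ψ x‖ ^ 2 := by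
    intro ψ
    rw [← hDs, hDin, Complex.re_sum]
    refine Finset.sum_congr rfl fun x _ => ?_
    rw [Complex.re_ofReal_mul, RCLike.star_def, mul_comm (_ : ℂ) (ψ x), Complex.mul_conj,
      Complex.ofReal_re, Complex.normSq_eq_norm_sq]
  -- The compression of the weight to `U`. It need not commute with `A`; only its own eigenvectors
  -- are used.
  let M : U →ₗ[ℂ] U := U.orthogonalProjectionOnto.toLinearMap ∘ₗ D ∘ₗ U.subtype
  have hMin : ∀ u w : U, inner ℂ u (M w) = inner ℂ (u : EuclideanSpace ℂ ι) (D w) := by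
    intro u w
    exact Submodule.inner_orthogonalProjectionOnto_eq_of_mem_left u (D w)
  have hMs : LinearMap.IsSymmetric (𝕜 := ℂ) (E := U) M := by
    intro u w
    rw [hMin, ← inner_conj_symm, hMin, inner_conj_symm]
    exact hDs u w
  rw [← hDself φ]
  refine (congrArg Complex.re (hMin ⟨φ, hφ⟩ ⟨φ, hφ⟩)).symm.trans_le ?_
  refine hMs.re_inner_le_of_eigenvalues_le (fun m hm => ?_) ⟨φ, hφ⟩
  obtain ⟨w, hw⟩ := hm.exists_hasEigenvector
  have hw0 : 0 < ‖(w : EuclideanSpace ℂ ι)‖ ^ 2 := by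
    have : (w : EuclideanSpace ℂ ι) ≠ 0 := fun h => hw.2 (Subtype.ext h)
    positivity
  have hMw : M w = (m : ℂ) • w := hw.apply_eq_smul
  have hin : ∀ u : U, inner ℂ (D w) (u : EuclideanSpace ℂ ι) =
      (m : ℂ) * inner ℂ (w : EuclideanSpace ℂ ι) (u : EuclideanSpace ℂ ι) := by
    intro u
    have h : inner ℂ u ((m : ℂ) • w) = (m : ℂ) * inner ℂ (u : EuclideanSpace ℂ ι) w :=
      inner_smul_right (u : EuclideanSpace ℂ ι) (w : EuclideanSpace ℂ ι) (m : ℂ)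
    rw [← inner_conj_symm, ← hMin, hMw, h, map_mul, Complex.conj_ofReal, inner_conj_symm]
  have hm1 : ∑ x, F x * ‖(w : EuclideanSpace ℂ ι) x‖ ^ 2 = m * ‖(w : EuclideanSpace ℂ ι)‖ ^ 2 := by
    rw [← hDself, ← hDs, hin, Complex.re_ofReal_mul, inner_self_eq_norm_sq_to_K]
    norm_cast
  -- The sign lets the energy bound ⟨w, Aw⟩ ≤ E₁‖w‖² be multiplied by `m`.
  have hm0 : 0 ≤ m := by
    have : 0 ≤ m * ‖(w : EuclideanSpace ℂ ι)‖ ^ 2 :=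
      hm1 ▸ Finset.sum_nonneg fun x _ => mul_nonneg (hF x) (sq_nonneg _)
    exact nonneg_of_mul_nonneg_left this hw0
  have h1 := hcoer w
  -- Dw and mw differ by a vector orthogonal to `U`, and Aw stays in `U`, so the weight acts on this
  -- pairing as the scalar `m`.
  have h2 := hin ⟨_, iSup_eigenspace_invariant _ J _ w.2⟩
  rw [← hDin, h2, Complex.re_ofReal_mul, hm1] at h1
  have h3 := mul_le_mul_of_nonneg_left (hT.re_inner_le_of_mem_iSup_eigenspace hJ w.2) hm0
  rw [le_div_iff₀ (sub_pos.2 hc)]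
  refine le_of_mul_le_mul_right ?_ hw0
  linarith

/-- Everything rests on ⟨δ, Pδ⟩ = ‖Pδ‖². The first part is then Cauchy–Schwarz. For the second, φ =
Pδ has φ(x) = ‖Pδ‖², and one factor ‖Pδ‖² cancels; `0 ≤ K` covers Pδ = 0. -/
theorem spectralProjection_localDOS_bounds {ι : Type} [Fintype ι] [DecidableEq ι]
    {A : Matrix ι ι ℂ} (J : Set ℝ) (x : ι) :
    (∀ ψ ∈ (XXZ.spectralProjection A J).range, ‖ψ‖ = 1 → ‖ψ x‖ ^ 2 ≤
      (inner ℂ (EuclideanSpace.single x (1 : ℂ))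
        (XXZ.spectralProjection A J (EuclideanSpace.single x (1 : ℂ)))).re) ∧
    (∀ (f K : ℝ), (∀ φ ∈ ⨆ E ∈ J, Module.End.eigenspace (Matrix.toEuclideanLin A) (E : ℂ),
        f * ‖φ x‖ ^ 2 ≤ K * ‖φ‖ ^ 2) → 0 ≤ K →
      f * (inner ℂ (EuclideanSpace.single x (1 : ℂ))
        (XXZ.spectralProjection A J (EuclideanSpace.single x (1 : ℂ)))).re ≤ K) := by
  set U := ⨆ E ∈ J, Module.End.eigenspace (Matrix.toEuclideanLin A) (E : ℂ) with hU
  have hP : XXZ.spectralProjection A J = U.starProjection := rfl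
  rw [hP]
  set δ : EuclideanSpace ℂ ι := EuclideanSpace.single x (1 : ℂ)
  have hself : inner ℂ δ (U.starProjection δ) = ((‖U.starProjection δ‖ ^ 2 : ℝ) : ℂ) := by
    have h := Submodule.inner_starProjection_left_eq_right U δ (U.starProjection δ)
    rw [Submodule.starProjection_eq_self_iff.2 (U.starProjection_apply_mem δ)] at h
    rw [← h, inner_self_eq_norm_sq_to_K]
    norm_cast
  have hval : ∀ ψ : EuclideanSpace ℂ ι, inner ℂ δ ψ = ψ x := by
    intro ψ
    simp [δ, EuclideanSpace.inner_single_left]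
  rw [hself, Complex.ofReal_re]
  constructor
  · intro ψ hψ h1
    have hψU : ψ ∈ U := by
      obtain ⟨χ, rfl⟩ := hψ
      exact U.starProjection_apply_mem χ
    have : ψ x = inner ℂ (U.starProjection δ) ψ := by
      rw [Submodule.inner_starProjection_left_eq_right, Submodule.starProjection_eq_self_iff.2 hψU,
        hval]
    rw [this]
    gcongr
    simpa [h1] using norm_inner_le_norm (𝕜 := ℂ) (U.starProjection δ) ψ
  · intro f K h hK
    have := h _ (U.starProjection_apply_mem δ)
    rw [← hval, hself, Complex.norm_real, Real.norm_of_nonneg (sq_nonneg _)] at this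
    rcases (sq_nonneg ‖U.starProjection δ‖).eq_or_lt with h0 | h0
    · rw [← h0, mul_zero]; exact hK
    · refine le_of_mul_le_mul_right ?_ h0
      linarith

/-! ### The Hamiltonian in the configuration basis -/

noncomputable section

namespace XXZ

/-- The configuration obtained from `x` by exchanging the spins at `s` and `s + 1`. -/
def exchange {a b : ℤ} (s : ℤ) (x : Config a b) : Config a b :=
  ⟨(Finset.Icc a b).filter fun t => Equiv.swap s (s + 1) t ∈ x.1,
    Finset.mem_powerset.2 (Finset.filter_subset _ _)⟩

/-- The indicator that the spins at `s` and `s + 1` differ. -/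
def bondUnlike (s : ℤ) (x : Finset ℤ) : ℝ := if (s ∈ x ↔ s + 1 ∈ x) then 0 else 1

/-- The occupation number of the site `s`. -/
def occ (s : ℤ) (x : Finset ℤ) : ℝ := if s ∈ x then 1 else 0

theorem bondUnlike_nonneg (s : ℤ) (x : Finset ℤ) : 0 ≤ bondUnlike s x := by
  unfold bondUnlike; split_ifs <;> norm_num

theorem occ_nonneg (s : ℤ) (x : Finset ℤ) : 0 ≤ occ s x := by
  unfold occ; split_ifs <;> norm_num

theorem Config.ext_iff {a b : ℤ} {x y : Config a b} :
    x = y ↔ ∀ t ∈ Finset.Icc a b, (t ∈ x.1 ↔ t ∈ y.1) := by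
  constructor
  · rintro rfl t _; rfl
  · intro h
    refine Subtype.ext (Finset.ext fun t => ?_)
    by_cases ht : t ∈ Finset.Icc a b
    · exact h t ht
    · exact iff_of_false (fun hx => ht (Finset.mem_powerset.1 x.2 hx))
        (fun hy => ht (Finset.mem_powerset.1 y.2 hy))

theorem spinAt_eq_iff {x y : Finset ℤ} {s t : ℤ} : spinAt x s = spinAt y t ↔ (s ∈ x ↔ t ∈ y) := by
  unfold spinAt; split_ifs <;> simp_all

section

variable {a b s : ℤ}

theorem mem_exchange_left (hs : s ∈ Finset.Ico a b) (x : Config a b) :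
    s ∈ (exchange s x).1 ↔ s + 1 ∈ x.1 := by
  rw [Finset.mem_Ico] at hs
  simp [exchange, hs.1, hs.2.le]

theorem mem_exchange_right (hs : s ∈ Finset.Ico a b) (x : Config a b) :
    s + 1 ∈ (exchange s x).1 ↔ s ∈ x.1 := by
  rw [Finset.mem_Ico] at hs
  have h1 : a ≤ s + 1 := by omega
  have h2 : s + 1 ≤ b := by omega
  simp [exchange, h1, h2]

theorem mem_exchange_of_ne {t : ℤ} (h1 : t ≠ s) (h2 : t ≠ s + 1) (x : Config a b) :
    t ∈ (exchange s x).1 ↔ t ∈ x.1 := by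
  simp only [exchange, Finset.mem_filter, Equiv.swap_apply_of_ne_of_ne h1 h2]
  exact and_iff_right_of_imp fun h => Finset.mem_powerset.1 x.2 h

theorem exchange_exchange (hs : s ∈ Finset.Ico a b) (x : Config a b) :
    exchange s (exchange s x) = x := by
  rw [Config.ext_iff]
  intro t _
  by_cases h1 : t = s
  · rw [h1, mem_exchange_left hs, mem_exchange_right hs]
  by_cases h2 : t = s + 1
  · rw [h2, mem_exchange_right hs, mem_exchange_left hs]
  rw [mem_exchange_of_ne h1 h2, mem_exchange_of_ne h1 h2]

theorem bondUnlike_exchange (hs : s ∈ Finset.Ico a b) (x : Config a b) :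
    bondUnlike s (exchange s x).1 = bondUnlike s x.1 := by
  simp only [bondUnlike, mem_exchange_left hs, mem_exchange_right hs]
  congr 1
  exact propext Iff.comm

theorem eq_exchange_iff (hs : s ∈ Finset.Ico a b) {x y : Config a b} :
    y = exchange s x ↔ (∀ t ∈ Finset.Icc a b, t ≠ s → t ≠ s + 1 → spinAt x.1 t = spinAt y.1 t) ∧
      spinAt y.1 s = spinAt x.1 (s + 1) ∧ spinAt y.1 (s + 1) = spinAt x.1 s := by
  simp only [spinAt_eq_iff]
  constructor
  · rintro rfl
    exact ⟨fun t _ h1 h2 => (mem_exchange_of_ne h1 h2 x).symm, mem_exchange_left hs x,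
      mem_exchange_right hs x⟩
  · rintro ⟨h, hl, hr⟩
    rw [Config.ext_iff]
    intro t ht
    by_cases h1 : t = s
    · rw [h1, mem_exchange_left hs, hl]
    by_cases h2 : t = s + 1
    · rw [h2, mem_exchange_right hs, hr]
    rw [mem_exchange_of_ne h1 h2, h t ht h1 h2]

theorem eq_iff_spinAt {x y : Config a b} (s : ℤ) :
    y = x ↔ (∀ t ∈ Finset.Icc a b, t ≠ s → t ≠ s + 1 → spinAt x.1 t = spinAt y.1 t) ∧
      spinAt y.1 s = spinAt x.1 s ∧ spinAt y.1 (s + 1) = spinAt x.1 (s + 1) := by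
  constructor
  · rintro rfl
    exact ⟨fun _ _ _ _ => rfl, rfl, rfl⟩
  · rintro ⟨h, hl, hr⟩
    rw [Config.ext_iff]
    intro t ht
    rw [← spinAt_eq_iff]
    by_cases h1 : t = s
    · rw [h1, hl]
    by_cases h2 : t = s + 1
    · rw [h2, hr]
    exact (h t ht h1 h2).symm

theorem siteOp_mul_siteOp_succ (hs : s ∈ Finset.Ico a b) (M N : Matrix (Fin 2) (Fin 2) ℂ)
    (x y : Config a b) :
    (siteOp a b s M * siteOp a b (s + 1) N) x y =
      if ∀ t ∈ Finset.Icc a b, t ≠ s → t ≠ s + 1 → spinAt x.1 t = spinAt y.1 t then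
        M (spinAt x.1 s) (spinAt y.1 s) * N (spinAt x.1 (s + 1)) (spinAt y.1 (s + 1)) else 0 := by
  have hss : s + 1 ≠ s := by omega
  have hs0 : s ∈ Finset.Icc a b := by rw [Finset.mem_Ico] at hs; rw [Finset.mem_Icc]; omega
  have hs1 : s + 1 ∈ Finset.Icc a b := by rw [Finset.mem_Ico] at hs; rw [Finset.mem_Icc]; omega
  -- The only intermediate configuration that can contribute to the matrix product: `y` at the site
  -- `s`, `x` elsewhere.
  let z : Config a b := ⟨(Finset.Icc a b).filter fun t => if t = s then t ∈ y.1 else t ∈ x.1,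
    Finset.mem_powerset.2 (Finset.filter_subset _ _)⟩
  have hzs : spinAt z.1 s = spinAt y.1 s := by
    rw [spinAt_eq_iff]; simp only [z, Finset.mem_filter, if_true, hs0, true_and]
  have hzx : ∀ t ∈ Finset.Icc a b, t ≠ s → spinAt x.1 t = spinAt z.1 t := by
    intro t ht h
    rw [spinAt_eq_iff]; simp only [z, Finset.mem_filter, h, if_false, ht, true_and]
  rw [Matrix.mul_apply]
  simp only [siteOp, Matrix.of_apply]
  split_ifs with h
  · rw [Finset.sum_eq_single z]
    · have h2 : ∀ t ∈ Finset.Icc a b, t ≠ s + 1 → spinAt z.1 t = spinAt y.1 t := by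
        intro t ht hne
        by_cases h1 : t = s
        · rw [h1, hzs]
        · rw [← hzx t ht h1, h t ht h1 hne]
      rw [if_pos hzx, if_pos h2, hzs, hzx _ hs1 hss]
    · intro w _ hw
      rw [mul_eq_zero]
      by_contra! hcon
      have h1 : ∀ t ∈ Finset.Icc a b, t ≠ s → spinAt x.1 t = spinAt w.1 t := by
        by_contra h1; exact hcon.1 (if_neg h1)
      have h2 : ∀ t ∈ Finset.Icc a b, t ≠ s + 1 → spinAt w.1 t = spinAt y.1 t := by
        by_contra h2; exact hcon.2 (if_neg h2)
      refine hw (Config.ext_iff.2 fun t ht => spinAt_eq_iff.1 ?_)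
      by_cases hts : t = s
      · rw [hts, hzs, h2 s hs0 hss.symm]
      · rw [← hzx t ht hts, h1 t ht hts]
    · intro hz
      exact absurd (Finset.mem_univ _) hz
  · refine Finset.sum_eq_zero fun w _ => ?_
    rw [mul_eq_zero]
    by_contra! hcon
    have h1 : ∀ t ∈ Finset.Icc a b, t ≠ s → spinAt x.1 t = spinAt w.1 t := by
      by_contra h1; exact hcon.1 (if_neg h1)
    have h2 : ∀ t ∈ Finset.Icc a b, t ≠ s + 1 → spinAt w.1 t = spinAt y.1 t := by
      by_contra h2; exact hcon.2 (if_neg h2)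
    exact h fun t ht hne hne' => (h1 t ht hne).trans (h2 t ht hne')

theorem bondUnlike_eq_spinAt (s : ℤ) (x : Finset ℤ) :
    bondUnlike s x = if spinAt x s = spinAt x (s + 1) then 0 else 1 := by
  simp only [bondUnlike, spinAt_eq_iff]

/-- The entries flipping two like spins cancel between S¹S¹ and S²S², while those swapping unlike
spins add up to 1/2. -/
theorem planar_bond_apply (hs : s ∈ Finset.Ico a b) (x y : Config a b) :
    (siteOp a b s S1 * siteOp a b (s + 1) S1 + siteOp a b s S2 * siteOp a b (s + 1) S2) x y =
      if y = exchange s x then ((bondUnlike s x.1 / 2 : ℝ) : ℂ) else 0 := by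
  rw [Matrix.add_apply, siteOp_mul_siteOp_succ hs, siteOp_mul_siteOp_succ hs]
  simp only [eq_exchange_iff hs, bondUnlike_eq_spinAt]
  split_ifs with h h1 h2 h2
  · obtain ⟨-, hl, hr⟩ := h1
    rw [hl, hr, h2]
    generalize spinAt x.1 (s + 1) = i
    fin_cases i <;> simp [S1, S2]
  · obtain ⟨-, hl, hr⟩ := h1
    rw [hl, hr]
    revert h2
    generalize spinAt x.1 (s + 1) = i
    generalize spinAt x.1 s = j
    intro h2
    fin_cases i <;> fin_cases j <;> simp [S1, S2] at h2 ⊢ <;> ring_nf <;> simp <;> norm_num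
  · have h1' : ¬ (spinAt y.1 s = spinAt x.1 (s + 1) ∧ spinAt y.1 (s + 1) = spinAt x.1 s) :=
      fun hh => h1 ⟨h, hh⟩
    revert h1'
    generalize spinAt x.1 (s + 1) = i
    generalize spinAt x.1 s = j
    generalize spinAt y.1 (s + 1) = k
    generalize spinAt y.1 s = l
    intro h1'
    fin_cases i <;> fin_cases j <;> fin_cases k <;> fin_cases l <;> simp [S1, S2] at h1' ⊢ <;>
      ring_nf <;> simp
  · simp_all
  · simp_all
  · simp

theorem ising_bond_apply (hs : s ∈ Finset.Ico a b) (x y : Config a b) :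
    (siteOp a b s S3 * siteOp a b (s + 1) S3 - (1 / 4 : ℂ) • 1) x y =
      if y = x then ((-(bondUnlike s x.1 / 2) : ℝ) : ℂ) else 0 := by
  rw [Matrix.sub_apply, siteOp_mul_siteOp_succ hs, Matrix.smul_apply, Matrix.one_apply]
  simp only [eq_comm (a := x) (b := y), eq_iff_spinAt s, bondUnlike_eq_spinAt]
  split_ifs with h h1 h2 h2
  · obtain ⟨-, hl, hr⟩ := h1
    rw [hl, hr, h2]
    generalize spinAt x.1 (s + 1) = i
    fin_cases i <;> simp [S3] <;> norm_num
  · obtain ⟨-, hl, hr⟩ := h1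
    rw [hl, hr]
    revert h2
    generalize spinAt x.1 (s + 1) = i
    generalize spinAt x.1 s = j
    intro h2
    fin_cases i <;> fin_cases j <;> simp [S3] at h2 ⊢ <;> norm_num
  · have h1' : ¬ (spinAt y.1 s = spinAt x.1 s ∧ spinAt y.1 (s + 1) = spinAt x.1 (s + 1)) :=
      fun hh => h1 ⟨h, hh⟩
    revert h1'
    generalize spinAt x.1 (s + 1) = i
    generalize spinAt x.1 s = j
    generalize spinAt y.1 (s + 1) = k
    generalize spinAt y.1 s = l
    intro h1'
    fin_cases i <;> fin_cases j <;> fin_cases k <;> fin_cases l <;> simp [S3] at h1' ⊢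
  · simp_all
  · simp_all
  · simp

theorem siteOp_S3_apply (s : ℤ) (x y : Config a b) :
    siteOp a b s S3 x y = if y = x then ((1 / 2 - occ s x.1 : ℝ) : ℂ) else 0 := by
  simp only [siteOp, Matrix.of_apply]
  by_cases h : y = x
  · subst h
    rw [if_pos rfl, if_pos fun _ _ _ => rfl]
    unfold occ spinAt
    split_ifs <;> simp [S3] <;> norm_num
  · rw [if_neg h]
    split_ifs with h1
    · have hne : spinAt x.1 s ≠ spinAt y.1 s := by
        intro he
        refine h (Config.ext_iff.2 fun t ht => spinAt_eq_iff.1 ?_)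
        by_cases hts : t = s
        · rw [hts, he]
        · exact (h1 t ht hts).symm
      revert hne
      generalize spinAt x.1 s = i
      generalize spinAt y.1 s = j
      intro hne
      fin_cases i <;> fin_cases j <;> simp [S3] at hne ⊢
    · rfl

end

/-- The diagonal part of the Hamiltonian coming from the boundary terms and the external field. -/
def sitePotential (q : ℝ) (a b : ℤ) (v : ℤ → ℝ) (x : Finset ℤ) : ℝ :=
  (1 - q) / 2 * (occ a x + occ b x) + ∑ s ∈ Finset.Icc a b, v s * occ s x

/-- Ising and planar terms combine bond by bond with the same factor `bondUnlike s x / 2`, so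
hopping can be compared with the diagonal on each bond separately. -/
theorem hamiltonian_apply (q : ℝ) {a b : ℤ} (v : ℤ → ℝ) (x y : Config a b) :
    hamiltonian q a b v x y =
      ∑ s ∈ Finset.Ico a b, ((bondUnlike s x.1 / 2 : ℝ) : ℂ) *
        ((if y = x then 1 else 0) - q * (if y = exchange s x then 1 else 0)) +
      (sitePotential q a b v x.1 : ℂ) * (if y = x then 1 else 0) := by
  have e1 : (∑ s ∈ Finset.Ico a b, (siteOp a b s S1 * siteOp a b (s + 1) S1 +
      siteOp a b s S2 * siteOp a b (s + 1) S2)) x y = ∑ s ∈ Finset.Ico a b,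
        if y = exchange s x then ((bondUnlike s x.1 / 2 : ℝ) : ℂ) else 0 := by
    rw [Matrix.sum_apply]
    exact Finset.sum_congr rfl fun s hs => planar_bond_apply hs x y
  have e2 : (∑ s ∈ Finset.Ico a b, (siteOp a b s S3 * siteOp a b (s + 1) S3 - (1 / 4 : ℂ) • 1)) x y =
      ∑ s ∈ Finset.Ico a b, if y = x then ((-(bondUnlike s x.1 / 2) : ℝ) : ℂ) else 0 := by
    rw [Matrix.sum_apply]
    exact Finset.sum_congr rfl fun s hs => ising_bond_apply hs x y
  have e3 : (∑ s ∈ Finset.Icc a b, (v s : ℂ) • ((1 / 2 : ℂ) • 1 - siteOp a b s S3)) x y =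
      ∑ s ∈ Finset.Icc a b, (v s : ℂ) * if y = x then (occ s x.1 : ℂ) else 0 := by
    rw [Matrix.sum_apply]
    refine Finset.sum_congr rfl fun s hs => ?_
    rw [Matrix.smul_apply, Matrix.sub_apply, Matrix.smul_apply, siteOp_S3_apply s,
      Matrix.one_apply]
    simp only [eq_comm (a := x) (b := y)]
    split_ifs <;> push_cast <;> simp
  rw [hamiltonian, hXXZ, Matrix.add_apply, Matrix.add_apply, Matrix.sub_apply, Matrix.neg_apply,
    Matrix.smul_apply, Matrix.smul_apply, e1, e2, e3, Matrix.sub_apply, Matrix.sub_apply,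
    siteOp_S3_apply a, siteOp_S3_apply b,
    Matrix.one_apply, sitePotential]
  simp only [eq_comm (a := x) (b := y), mul_sub, Finset.sum_sub_distrib, smul_eq_mul]
  have e4 : ∀ s, ((bondUnlike s x.1 / 2 : ℝ) : ℂ) * (q * if y = exchange s x then 1 else 0) =
      q * if y = exchange s x then ((bondUnlike s x.1 / 2 : ℝ) : ℂ) else 0 := by
    intro s; split_ifs <;> ring
  simp only [e4, ← Finset.mul_sum]
  by_cases h : y = x
  · simp only [h, if_true, mul_one]
    push_cast
    rw [Finset.sum_neg_distrib]
    ring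
  · simp only [h, if_false, mul_zero, Finset.sum_const_zero]
    ring

theorem hamiltonian_isHermitian (q : ℝ) (a b : ℤ) (v : ℤ → ℝ) :
    (hamiltonian q a b v).IsHermitian := by
  refine Matrix.IsHermitian.ext fun x y => ?_
  have hex : ∀ s ∈ Finset.Ico a b, x = exchange s y ↔ y = exchange s x := fun s hs =>
    ⟨fun h => by rw [h, exchange_exchange hs], fun h => by rw [h, exchange_exchange hs]⟩
  rw [hamiltonian_apply q, hamiltonian_apply q, star_add, star_sum, star_mul']
  congr 1
  · refine Finset.sum_congr rfl fun s hs => ?_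
    simp only [hex s hs, eq_comm (a := x) (b := y)]
    by_cases h : y = x ∨ y = exchange s x
    · have hu : bondUnlike s y.1 = bondUnlike s x.1 := by
        rcases h with h | h
        · rw [h]
        · rw [h, bondUnlike_exchange hs]
      rw [hu]
      split_ifs <;> simp
    · rw [not_or] at h
      simp [h.1, h.2]
  · by_cases h1 : y = x
    · subst h1
      simp [Complex.conj_ofReal]
    · simp [h1, Ne.symm h1]

theorem toEuclideanLin_hamiltonian_apply (q : ℝ) {a b : ℤ} (v : ℤ → ℝ)
    (ψ : HilbertSpace a b) (x : Config a b) :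
    Matrix.toEuclideanLin (hamiltonian q a b v) ψ x =
      ∑ s ∈ Finset.Ico a b, ((bondUnlike s x.1 / 2 : ℝ) : ℂ) * (ψ x - q * ψ (exchange s x)) +
      (sitePotential q a b v x.1 : ℂ) * ψ x := by
  have e : Matrix.toEuclideanLin (hamiltonian q a b v) ψ x =
      ∑ y, hamiltonian q a b v x y * ψ y := rfl
  rw [e]
  simp only [hamiltonian_apply q, add_mul, Finset.sum_mul, Finset.sum_add_distrib]
  rw [Finset.sum_comm]
  congr 1
  · refine Finset.sum_congr rfl fun s _ => ?_
    simp only [mul_assoc, sub_mul, ← Finset.mul_sum, Finset.sum_sub_distrib, ite_mul, one_mul,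
      zero_mul, Finset.sum_ite_eq', Finset.mem_univ, if_true]
  · simp only [mul_assoc, ← Finset.mul_sum, ite_mul, one_mul, zero_mul, Finset.sum_ite_eq',
      Finset.mem_univ, if_true]

end XXZ

end

/-! ### Counting domain walls -/

noncomputable section

namespace XXZ

theorem sum_Ico_int_consecutive (f : ℤ → ℝ) {c d e : ℤ} (hcd : c ≤ d) (hde : d ≤ e) :
    ∑ s ∈ Finset.Ico c d, f s + ∑ s ∈ Finset.Ico d e, f s = ∑ s ∈ Finset.Ico c e, f s := by
  rw [← Finset.Ico_union_Ico_eq_Ico hcd hde,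
    Finset.sum_union (Finset.Ico_disjoint_Ico_consecutive c d e)]

theorem abs_occ_sub_occ_succ_le (x : Finset ℤ) (s : ℤ) :
    |occ s x - occ (s + 1) x| ≤ bondUnlike s x := by
  unfold occ bondUnlike
  split_ifs <;> simp_all

theorem abs_occ_sub_occ_le (x : Finset ℤ) (c : ℤ) {d : ℤ} (hcd : c ≤ d) :
    |occ c x - occ d x| ≤ ∑ s ∈ Finset.Ico c d, bondUnlike s x := by
  induction d, hcd using Int.leInduction with
  | base => simp
  | succ d hcd ih =>
    rw [← sum_Ico_int_consecutive _ hcd (by omega : d ≤ d + 1)]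
    have h1 : Finset.Ico d (d + 1) = {d} := by
      ext t; simp only [Finset.mem_Ico, Finset.mem_singleton]; omega
    rw [h1, Finset.sum_singleton]
    exact (abs_sub_le _ (occ d x) _).trans (add_le_add ih (abs_occ_sub_occ_succ_le x d))

theorem exists_gap_of_not_isClustered {x : Finset ℤ} (hx : ¬ IsClustered x) :
    ∃ i j k : ℤ, i < j ∧ j < k ∧ i ∈ x ∧ j ∉ x ∧ k ∈ x := by
  rcases x.eq_empty_or_nonempty with rfl | hne
  · exact absurd ⟨1, 0, rfl⟩ hx
  by_contra! hcon
  refine hx ⟨x.min' hne, x.max' hne, Finset.Subset.antisymm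
    (fun t ht => Finset.mem_Icc.2 ⟨x.min'_le t ht, x.le_max' t ht⟩) fun t ht => ?_⟩
  rw [Finset.mem_Icc] at ht
  by_contra htx
  have h1 := x.min'_mem hne
  have h2 := x.max'_mem hne
  have h3 : x.min' hne < t := lt_of_le_of_ne ht.1 fun h => htx (h ▸ h1)
  have h4 : t < x.max' hne := lt_of_le_of_ne ht.2 fun h => htx (h ▸ h2)
  exact hcon _ _ _ h3 h4 h1 htx h2

/-- Take a hole j between particles i < k. The stretches i to j and j to k each contain a wall, and
so does each outer stretch unless its end of the chain is occupied. -/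
theorem four_le_surface {a b : ℤ} (x : Config a b) (hx : ¬ IsClustered x.1) :
    4 ≤ ∑ s ∈ Finset.Ico a b, bondUnlike s x.1 + (occ a x.1 + occ b x.1) := by
  obtain ⟨i, j, k, hij, hjk, hi, hj, hk⟩ := exists_gap_of_not_isClustered hx
  have hia := (Finset.mem_Icc.1 (Finset.mem_powerset.1 x.2 hi)).1
  have hkb := (Finset.mem_Icc.1 (Finset.mem_powerset.1 x.2 hk)).2
  have oi : occ i x.1 = 1 := if_pos hi
  have oj : occ j x.1 = 0 := if_neg hj
  have ok : occ k x.1 = 1 := if_pos hk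
  rw [← sum_Ico_int_consecutive _ hia (by omega : i ≤ b),
    ← sum_Ico_int_consecutive _ hij.le (by omega : j ≤ b),
    ← sum_Ico_int_consecutive _ hjk.le hkb]
  have h1 := neg_le_of_abs_le (abs_occ_sub_occ_le x.1 a hia)
  have h2 := le_of_abs_le (abs_occ_sub_occ_le x.1 i hij.le)
  have h3 := neg_le_of_abs_le (abs_occ_sub_occ_le x.1 j hjk.le)
  have h4 := le_of_abs_le (abs_occ_sub_occ_le x.1 k hkb)
  linarith

/-! ### Exchanges and the distance to clustered configurations -/

section Distance

variable {a b s : ℤ}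

theorem exchange_eq_map (hs : s ∈ Finset.Ico a b) (x : Config a b) :
    (exchange s x).1 = x.1.map (Equiv.swap s (s + 1)).toEmbedding := by
  ext t
  rw [Finset.mem_map_equiv, Equiv.symm_swap]
  by_cases h1 : t = s
  · rw [h1, mem_exchange_left hs, Equiv.swap_apply_left]
  by_cases h2 : t = s + 1
  · rw [h2, mem_exchange_right hs, Equiv.swap_apply_right]
  rw [mem_exchange_of_ne h1 h2, Equiv.swap_apply_of_ne_of_ne h1 h2]

theorem card_exchange (hs : s ∈ Finset.Ico a b) (x : Config a b) :
    (exchange s x).1.card = x.1.card := by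
  rw [exchange_eq_map hs, Finset.card_map]

/-- Since `s` and `s + 1` are not both occupied, the transposition preserves the order of the
particles, so their labels do not change. -/
theorem orderEmbOfFin_exchange (hs : s ∈ Finset.Ico a b) {x : Config a b}
    (hu : ¬ (s ∈ x.1 ↔ s + 1 ∈ x.1)) {n : ℕ} (hx : x.1.card = n)
    (hx' : (exchange s x).1.card = n) (k : Fin n) :
    (exchange s x).1.orderEmbOfFin hx' k = Equiv.swap s (s + 1) (x.1.orderEmbOfFin hx k) := by
  refine (congrFun (Finset.orderEmbOfFin_unique hx'
    (f := fun k => Equiv.swap s (s + 1) (x.1.orderEmbOfFin hx k)) (fun i => ?_) fun i j hij => ?_)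
      k).symm
  · rw [exchange_eq_map hs, Finset.mem_map_equiv, Equiv.symm_swap, Equiv.swap_apply_self]
    exact Finset.orderEmbOfFin_mem _ _ _
  · have hlt := (x.1.orderEmbOfFin hx).strictMono hij
    have hi := Finset.orderEmbOfFin_mem x.1 hx i
    have hj := Finset.orderEmbOfFin_mem x.1 hx j
    have hne : ¬ (x.1.orderEmbOfFin hx i = s ∧ x.1.orderEmbOfFin hx j = s + 1) := by
      rintro ⟨h1, h2⟩
      rw [h1] at hi
      rw [h2] at hj
      exact hu (iff_of_true hi hj)
    simp only [Equiv.swap_apply_def]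
    split_ifs <;> omega

theorem configDist_exchange_le (hs : s ∈ Finset.Ico a b) {x : Config a b}
    (hu : ¬ (s ∈ x.1 ↔ s + 1 ∈ x.1)) {n : ℕ} (hx : x.1.card = n)
    (hx' : (exchange s x).1.card = n) {y : Finset ℤ} (hy : y.card = n) :
    configDist (exchange s x).1 y hx' hy ≤ configDist x.1 y hx hy + 1 := by
  -- `e` is the occupied site of the bond: its particle is the only one that moves, and it moves by
  -- one.
  obtain ⟨e, he⟩ : ∃ e : ℤ, ∀ t ∈ x.1, t ≠ e → Equiv.swap s (s + 1) t = t := by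
    by_cases h : s ∈ x.1
    · have h' : s + 1 ∉ x.1 := fun h' => hu (iff_of_true h h')
      exact ⟨s, fun t ht hne => Equiv.swap_apply_of_ne_of_ne hne fun h => h' (h ▸ ht)⟩
    · exact ⟨s + 1, fun t ht hne => Equiv.swap_apply_of_ne_of_ne (fun h' => h (h' ▸ ht)) hne⟩
  have hone : ∑ k : Fin n, (if x.1.orderEmbOfFin hx k = e then 1 else 0) ≤ 1 := by
    rw [← Finset.card_filter, Finset.card_le_one]
    intro i hi j hj
    rw [Finset.mem_filter] at hi hj
    exact (x.1.orderEmbOfFin hx).injective (hi.2.trans hj.2.symm)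
  refine le_trans ?_ (Nat.add_le_add_left hone _)
  unfold configDist
  rw [← Finset.sum_add_distrib]
  refine Finset.sum_le_sum fun k _ => ?_
  rw [orderEmbOfFin_exchange hs hu hx hx']
  have hk := Finset.orderEmbOfFin_mem x.1 hx k
  split_ifs with h
  · rw [Equiv.swap_apply_def]
    split_ifs <;> omega
  · rw [he _ hk h, add_zero]

theorem distToClustered_exchange_le (hs : s ∈ Finset.Ico a b) {x : Config a b}
    (hu : ¬ (s ∈ x.1 ↔ s + 1 ∈ x.1)) :
    distToClustered (exchange s x) ≤ distToClustered x + 1 := by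
  obtain ⟨y, hy, hyc, hm⟩ := Nat.sInf_mem (clusterDistSet_nonempty x)
  have hm' : distToClustered x = configDist x.1 y.1 rfl hy := hm
  rw [hm']
  have hc := card_exchange hs x
  refine le_trans (Nat.sInf_le ⟨y, hy.trans hc.symm, hyc, rfl⟩) ?_
  refine (configDist_exchange_le hs hu hc.symm rfl (hy.trans hc.symm)).trans_eq ?_
  have : ∀ (n : ℕ) (hn : x.1.card = n) (hy' : y.1.card = n),
      configDist x.1 y.1 hn hy' = configDist x.1 y.1 rfl hy := by
    rintro n rfl _; rfl
  rw [this]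

theorem abs_distToClustered_exchange_sub_le (hs : s ∈ Finset.Ico a b) {x : Config a b}
    (hu : ¬ (s ∈ x.1 ↔ s + 1 ∈ x.1)) :
    |(distToClustered x : ℝ) - distToClustered (exchange s x)| ≤ 1 := by
  have h1 := distToClustered_exchange_le hs hu
  have h2 := distToClustered_exchange_le hs (x := exchange s x)
    (by rw [mem_exchange_left hs, mem_exchange_right hs]; exact fun h => hu h.symm)
  rw [exchange_exchange hs] at h2
  rw [abs_le]
  constructor
  · have : (distToClustered (exchange s x) : ℝ) ≤ distToClustered x + 1 := by exact_mod_cast h1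
    linarith
  · have : (distToClustered x : ℝ) ≤ distToClustered (exchange s x) + 1 := by exact_mod_cast h2
    linarith

theorem distToClustered_eq_zero {x : Config a b} (hx : IsClustered x.1) :
    distToClustered x = 0 := by
  refine Nat.le_zero.1 (Nat.sInf_le ⟨x, rfl, hx, ?_⟩)
  simp [configDist]

end Distance

/-! ### The weighted coercivity estimate -/

/-- The exponential weight `exp (2 η d(x, 𝒞))`. -/
def clusterWeight (η : ℝ) {a b : ℤ} (x : Config a b) : ℝ := Real.exp (2 * η * distToClustered x)

theorem clusterWeight_add_exchange_le (η : ℝ) {a b s : ℤ} (hs : s ∈ Finset.Ico a b)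
    {x : Config a b} (hu : ¬ (s ∈ x.1 ↔ s + 1 ∈ x.1)) :
    clusterWeight η x + clusterWeight η (exchange s x) ≤
      2 * Real.cosh η * (Real.exp (η * distToClustered x) *
        Real.exp (η * distToClustered (exchange s x))) := by
  have h := abs_distToClustered_exchange_sub_le hs hu
  unfold clusterWeight
  set d : ℝ := (distToClustered x : ℝ)
  set d' : ℝ := (distToClustered (exchange s x) : ℝ)
  have hcosh : Real.cosh (η * (d - d')) ≤ Real.cosh η := by
    rw [Real.cosh_le_cosh, abs_mul]
    exact mul_le_of_le_one_right (abs_nonneg _) h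
  -- The arithmetic mean of the two weights is their geometric mean times cosh of half the
  -- difference of the exponents.
  have key : Real.exp (2 * η * d) + Real.exp (2 * η * d') =
      2 * Real.cosh (η * (d - d')) * (Real.exp (η * d) * Real.exp (η * d')) := by
    rw [Real.cosh_eq, mul_div_cancel₀ _ two_ne_zero, ← Real.exp_add, add_mul, ← Real.exp_add,
      ← Real.exp_add]
    congr 2 <;> ring
  rw [key]
  gcongr

/-- The exchange is an involution, so the hopping sum may carry the average of the weights at both
ends. That average is at most cosh η times their geometric mean, and AM–GM then returns the diagonal
sum. -/
theorem weighted_bond_le (η : ℝ) {a b s : ℤ} (hs : s ∈ Finset.Ico a b)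
    (ψ : HilbertSpace a b) :
    ∑ x, bondUnlike s x.1 * (clusterWeight η x * (star (ψ x) * ψ (exchange s x)).re) ≤
      Real.cosh η * ∑ x, bondUnlike s x.1 * (clusterWeight η x * ‖ψ x‖ ^ 2) := by
  let σ : Equiv.Perm (Config a b) := ⟨exchange s, exchange s, exchange_exchange hs, exchange_exchange hs⟩
  have e1 : ∑ x, bondUnlike s x.1 * (clusterWeight η x * (star (ψ x) * ψ (exchange s x)).re) =
      ∑ x, bondUnlike s x.1 *
        (clusterWeight η (exchange s x) * (star (ψ x) * ψ (exchange s x)).re) := by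
    rw [← Equiv.sum_comp σ]
    refine Finset.sum_congr rfl fun x _ => ?_
    change bondUnlike s (exchange s x).1 * (clusterWeight η (exchange s x) *
      (star (ψ (exchange s x)) * ψ (exchange s (exchange s x))).re) = _
    rw [bondUnlike_exchange hs, exchange_exchange hs]
    congr 2
    simp only [RCLike.star_def, Complex.mul_re, Complex.conj_re, Complex.conj_im]
    ring
  have e2 : ∑ x, bondUnlike s x.1 * (clusterWeight η x * ‖ψ x‖ ^ 2) =
      ∑ x : Config a b, bondUnlike s x.1 *
        (clusterWeight η (exchange s x) * ‖ψ (exchange s x)‖ ^ 2) := by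
    rw [← Equiv.sum_comp σ]
    refine Finset.sum_congr rfl fun x _ => ?_
    change bondUnlike s (exchange s x).1 * _ = _
    rw [bondUnlike_exchange hs]
    rfl
  have key : ∀ x : Config a b, bondUnlike s x.1 *
      (clusterWeight η x * (star (ψ x) * ψ (exchange s x)).re) + bondUnlike s x.1 *
        (clusterWeight η (exchange s x) * (star (ψ x) * ψ (exchange s x)).re) ≤
      Real.cosh η * (bondUnlike s x.1 * (clusterWeight η x * ‖ψ x‖ ^ 2) + bondUnlike s x.1 *
        (clusterWeight η (exchange s x) * ‖ψ (exchange s x)‖ ^ 2)) := by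
    intro x
    by_cases hu : s ∈ x.1 ↔ s + 1 ∈ x.1
    · simp [bondUnlike, hu]
    rw [bondUnlike, if_neg hu]
    simp only [one_mul]
    have h1 := clusterWeight_add_exchange_le η hs hu
    have h2 : (star (ψ x) * ψ (exchange s x)).re ≤ ‖ψ x‖ * ‖ψ (exchange s x)‖ := by
      refine (Complex.re_le_norm _).trans_eq ?_
      rw [norm_mul, norm_star]
    have hF : ∀ y : Config a b, clusterWeight η y = Real.exp (η * distToClustered y) ^ 2 := by
      intro y
      rw [clusterWeight, ← Real.exp_nat_mul]
      congr 1
      push_cast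
      ring
    have hpos : 0 ≤ clusterWeight η x + clusterWeight η (exchange s x) :=
      add_nonneg (Real.exp_nonneg _) (Real.exp_nonneg _)
    rw [← add_mul]
    refine (mul_le_mul_of_nonneg_left h2 hpos).trans ?_
    refine (mul_le_mul_of_nonneg_right h1 (by positivity)).trans ?_
    rw [hF, hF]
    have h3 := mul_le_mul_of_nonneg_left (two_mul_le_add_sq
      (Real.exp (η * distToClustered x) * ‖ψ x‖)
      (Real.exp (η * distToClustered (exchange s x)) * ‖ψ (exchange s x)‖)) (Real.cosh_pos η).le
    linarith
  have hsum := Finset.sum_le_sum fun x (_ : x ∈ Finset.univ) => key x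
  rw [Finset.sum_add_distrib, ← Finset.mul_sum, Finset.sum_add_distrib, ← e1, ← e2] at hsum
  linarith

theorem hamiltonian_coercive {q η : ℝ} (hq : 0 ≤ q) (hκ : 0 ≤ 1 - q * Real.cosh η)
    {a b : ℤ} {v : ℤ → ℝ} (hv : ∀ s ∈ Finset.Icc a b, 0 ≤ v s)
    (ψ : HilbertSpace a b) :
    2 * (1 - q * Real.cosh η) * (∑ x, clusterWeight η x * ‖ψ x‖ ^ 2 - ‖ψ‖ ^ 2) ≤
      (∑ x, (clusterWeight η x : ℂ) *
        (star (ψ x) * Matrix.toEuclideanLin (hamiltonian q a b v) ψ x)).re := by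
  have hterm : ∀ x, ((clusterWeight η x : ℂ) *
      (star (ψ x) * Matrix.toEuclideanLin (hamiltonian q a b v) ψ x)).re =
      ∑ s ∈ Finset.Ico a b, (bondUnlike s x.1 * (clusterWeight η x * ‖ψ x‖ ^ 2) / 2 -
        q / 2 * (bondUnlike s x.1 * (clusterWeight η x * (star (ψ x) * ψ (exchange s x)).re))) +
      sitePotential q a b v x.1 * (clusterWeight η x * ‖ψ x‖ ^ 2) := by
    intro x
    have hns : (star (ψ x) * ψ x).re = ‖ψ x‖ ^ 2 := by
      rw [RCLike.star_def, mul_comm, Complex.mul_conj, Complex.ofReal_re, Complex.normSq_eq_norm_sq]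
    rw [toEuclideanLin_hamiltonian_apply q, Complex.re_ofReal_mul, mul_add, Complex.add_re,
      Finset.mul_sum, Complex.re_sum, mul_add, Finset.mul_sum]
    congr 1
    · refine Finset.sum_congr rfl fun s _ => ?_
      rw [mul_left_comm, Complex.re_ofReal_mul, mul_sub, Complex.sub_re, mul_left_comm (star (ψ x)),
        Complex.re_ofReal_mul, hns]
      ring
    · rw [mul_left_comm (star (ψ x)), Complex.re_ofReal_mul, hns]
      ring
  have hbond : ∀ s ∈ Finset.Ico a b,
      ∑ x, (1 - q * Real.cosh η) / 2 * (bondUnlike s x.1 * (clusterWeight η x * ‖ψ x‖ ^ 2)) ≤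
      ∑ x, (bondUnlike s x.1 * (clusterWeight η x * ‖ψ x‖ ^ 2) / 2 -
        q / 2 * (bondUnlike s x.1 * (clusterWeight η x * (star (ψ x) * ψ (exchange s x)).re))) := by
    intro s hs
    have h := mul_le_mul_of_nonneg_left (weighted_bond_le η hs ψ) (by positivity : 0 ≤ q / 2)
    rw [Finset.sum_sub_distrib, ← Finset.mul_sum, ← Finset.mul_sum, ← Finset.sum_div]
    linarith
  rw [Complex.re_sum]
  simp only [hterm]
  rw [Finset.sum_add_distrib, Finset.sum_comm]
  -- Once hopping is absorbed bond by bond, only a diagonal form remains, to be bounded for each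
  -- configuration.
  refine le_trans ?_ (add_le_add_left (Finset.sum_le_sum hbond) _)
  rw [Finset.sum_comm, ← Finset.sum_add_distrib, EuclideanSpace.norm_sq_eq,
    ← Finset.sum_sub_distrib, Finset.mul_sum]
  refine Finset.sum_le_sum fun x _ => ?_
  have hw : 0 ≤ clusterWeight η x * ‖ψ x‖ ^ 2 := mul_nonneg (Real.exp_nonneg _) (sq_nonneg _)
  have hpot : (1 - q * Real.cosh η) / 2 * (occ a x.1 + occ b x.1) ≤ sitePotential q a b v x.1 := by
    have h1 : 0 ≤ ∑ s ∈ Finset.Icc a b, v s * occ s x.1 :=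
      Finset.sum_nonneg fun s hs => mul_nonneg (hv s hs) (occ_nonneg _ _)
    -- As cosh η ≥ 1, the boundary field is strong enough for an occupied end to count as a full
    -- domain wall.
    have h2 : (1 - q * Real.cosh η) / 2 ≤ (1 - q) / 2 := by
      have := mul_le_mul_of_nonneg_left (Real.one_le_cosh η) hq
      linarith
    have h3 := mul_le_mul_of_nonneg_right h2 (add_nonneg (occ_nonneg a x.1) (occ_nonneg b x.1))
    unfold sitePotential
    linarith
  have hpot' := mul_le_mul_of_nonneg_right hpot hw
  rw [← Finset.mul_sum, ← Finset.sum_mul]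
  -- On clustered configurations the weight is 1 and the lower bound sought is 0; elsewhere four
  -- walls turn (1 - q cosh η)/2 into 2(1 - q cosh η).
  by_cases hx : IsClustered x.1
  · have h1 : clusterWeight η x = 1 := by simp [clusterWeight, distToClustered_eq_zero hx]
    have h2 : 0 ≤ ∑ s ∈ Finset.Ico a b, bondUnlike s x.1 + (occ a x.1 + occ b x.1) :=
      add_nonneg (Finset.sum_nonneg fun s _ => bondUnlike_nonneg _ _)
        (add_nonneg (occ_nonneg _ _) (occ_nonneg _ _))
    have h3 := mul_nonneg (mul_nonneg (half_pos one_pos).le hκ) (mul_nonneg h2 hw)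
    rw [h1] at hw hpot' h3 ⊢
    linarith
  · have h4 := mul_le_mul_of_nonneg_left (mul_le_mul_of_nonneg_right (four_le_surface x hx) hw)
      (half_pos (α := ℝ) one_pos |>.le |> fun h => mul_nonneg h hκ)
    have h5 : 0 ≤ (1 - q * Real.cosh η) * ‖ψ x‖ ^ 2 := mul_nonneg hκ (sq_nonneg _)
    linarith

theorem exists_pos_lt_of_lt_gap {q E : ℝ} (hE : E < 2 * (1 - q)) :
    ∃ η : ℝ, 0 < η ∧ E < 2 * (1 - q * Real.cosh η) := by
  have hcont : Continuous fun η : ℝ => 2 * (1 - q * Real.cosh η) := by fun_prop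
  have hev : ∀ᶠ η in nhds (0 : ℝ), E < 2 * (1 - q * Real.cosh η) :=
    hcont.continuousAt.eventually_const_lt (by simpa using hE)
  obtain ⟨η, h1, h2⟩ := ((hev.filter_mono nhdsWithin_le_nhds).and
    (self_mem_nhdsWithin (s := Set.Ioi (0 : ℝ)))).exists
  exact ⟨η, h2, h1⟩

end XXZ

end

/-! ### Exponential decay of the local density of states -/

theorem mainTheorem3 (q : ℝ) (hq0 : 0 ≤ q) (hq1 : q < 1) (E₁ : ℝ) (hE₁ : E₁ < 2 * (1 - 3 * q)) :
    ∃ μ C : ℝ, 0 < μ ∧ 0 < C ∧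
      ∀ (a b : ℤ), a ≤ b → ∀ v : ℤ → ℝ, (∀ s ∈ Finset.Icc a b, 0 ≤ v s) →
        ∀ x : XXZ.Config a b,
          (∀ ψ : XXZ.HilbertSpace a b,
            ψ ∈ (XXZ.spectralProjection (XXZ.hamiltonian q a b v) (Set.Icc 0 E₁)).range →
            ‖ψ‖ = 1 →
            ‖ψ x‖ ^ 2 ≤ XXZ.localDOS q a b v (Set.Icc 0 E₁) x) ∧
          XXZ.localDOS q a b v (Set.Icc 0 E₁) x ≤
            C * Real.exp (-μ * (XXZ.distToClustered x : ℝ)) := by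
  -- The maximum with 0 makes c = 2(1 - q cosh η) positive as well as larger than `E₁`, so C = c/(c
  -- - E₁) is positive even for negative `E₁`.
  obtain ⟨η, hη, hgap⟩ := XXZ.exists_pos_lt_of_lt_gap (q := q) (E := max E₁ 0)
    (max_lt (by linarith) (by linarith))
  have hc := (le_max_left _ _).trans_lt hgap
  have hc0 := (le_max_right _ _).trans_lt hgap
  have hC := div_pos hc0 (sub_pos.2 hc)
  refine ⟨2 * η, _, by positivity, hC, fun a b _ v hv x => ?_⟩
  obtain ⟨h1, h2⟩ := spectralProjection_localDOS_bounds (A := XXZ.hamiltonian q a b v)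
    (Set.Icc 0 E₁) x
  refine ⟨h1, ?_⟩
  have h3 := h2 (XXZ.clusterWeight η x) _ (fun φ hφ => ?_) hC.le
  · rw [neg_mul, Real.exp_neg, ← div_eq_mul_inv, le_div_iff₀ (Real.exp_pos _), mul_comm]
    exact h3
  -- The weighted norm bounds each of its terms, in particular the one at `x`.
  · refine le_trans (Finset.single_le_sum (f := fun y => XXZ.clusterWeight η y * ‖φ y‖ ^ 2)
      (fun y _ => mul_nonneg (Real.exp_nonneg _) (sq_nonneg _)) (Finset.mem_univ x)) ?_
    exact weighted_norm_sq_le_of_mem_spectral (XXZ.hamiltonian_isHermitian q a b v)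
      (fun μ hμ => hμ.2) hc (fun y => Real.exp_nonneg _)
      (XXZ.hamiltonian_coercive hq0 (by linarith) hv) hφ
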